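/- Let $R$ be a commutative noetherian ring (for instance a dense noetherian subring of the ring of integers of a complete discretely valued field) and let $x=(x_1,\dots,x_n)$. For $w\in\mathbb{R}_{<0}\times\mathbb{R}^n$ and $f=\sum_{\beta,\alpha}c_{\alpha,\beta}\,t^\beta x^\alpha\in R[\![t]\!][x]$, the initial form $\mathrm{in}_w(f)\in R[t,x]$ is the sum of those terms $c_{\alpha,\beta}\,t^\beta x^\alpha$ of $f$ with $c_{\alpha,\beta}\neq 0$ for which $w\cdot(\beta,\alpha)$ is maximal. For an ideal $I\unlhd R[\![t]\!][x]$ put $\mathrm{in}_w(I)=\langle \mathrm{in}_w(f)\mid f\in I\rangle\unlhd R[t,x]$. When $\mathrm{in}_v(\cdot)$ or one of the notions below is applied to an ideal of $R[t,x]$, this ideal is replaced by the ideal that it generates in $R[\![t]\!][x]$. The ideal $I$ is called $x$-homogeneous if it is generated by elements that are homogeneous as polynomials in $x$ with coefficients in $R[\![t]\!]$. For an $x$-homogeneous ideal $I$ and $w\in\mathbb{R}_{<0}\times\mathbb{R}^n$, the Gröbner cone is $$C_w(I)=\overline{\{v\in\mathbb{R}_{<0}\times\mathbb{R}^n\mid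 \mathrm{in}_v(I)=\mathrm{in}_w(I)\}},$$ with the closure taken in the euclidean topology of $\mathbb{R}\times\mathbb{R}^n$, and the homogeneity space is $$C_0(I)=\bigcap_{w\in\mathbb{R}_{<0}\times\mathbb{R}^n}C_w(I).$$ **Lemma.** Let $I\unlhd R[\![t]\!][x]$ be an $x$-homogeneous ideal and $w\in\mathbb{R}_{<0}\times\mathbb{R}^n$. Then $$C_0(\mathrm{in}_w(I))=\overline{\{v\in\mathbb{R}_{<0}\times\mathbb{R}^n\mid \mathrm{in}_v(\mathrm{in}_w(I))=\mathrm{in}_w(I)\}}=\mathrm{Lin}(C_w(I))\cap(\mathbb{R}_{\le 0}\times\mathbb{R}^n),$$ where $\mathrm{Lin}$ denotes the linear span. -/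

import Mathlib

noncomputable section

namespace GroebnerFan

/-- The ring `R⟦t⟧[x]` with `x = (x₁, …, xₙ)`. -/
abbrev SeriesRing (R : Type*) [CommRing R] (n : ℕ) : Type _ :=
  MvPolynomial (Fin n) (PowerSeries R)

/-- The polynomial ring `R[t, x] = R[t][x]`. -/
abbrev PolyRing (R : Type*) [CommRing R] (n : ℕ) : Type _ :=
  MvPolynomial (Fin n) (Polynomial R)

/-- The inclusion `R[t, x] ⊆ R⟦t⟧[x]`. -/
def polyToSeries (R : Type*) [CommRing R] (n : ℕ) : PolyRing R n →+* SeriesRing R n :=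
  MvPolynomial.map Polynomial.coeToPowerSeries.ringHom

/-- The weight space `ℝ × ℝⁿ`; the first entry is the weight of `t`. All topological notions
refer to its usual (product, i.e. euclidean) topology. -/
abbrev Weight (n : ℕ) : Type := ℝ × (Fin n → ℝ)

/-- The open lower half space `ℝ_{<0} × ℝⁿ`. -/
def openLower (n : ℕ) : Set (Weight n) := {v | v.1 < 0}

/-- The closed lower half space `ℝ_{≤0} × ℝⁿ`. -/
def closedLower (n : ℕ) : Set (Weight n) := {v | v.1 ≤ 0}

/-- The weighted degree `w · (β, α)` of the monomial `t^β x^α`. -/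
def weightedDegree {n : ℕ} (w : Weight n) (β : ℕ) (α : Fin n →₀ ℕ) : ℝ :=
  w.1 * β + ∑ i, w.2 i * α i

/-- The coefficient of `t^β x^α` in `f ∈ R⟦t⟧[x]`. -/
def termCoeff {R : Type*} [CommRing R] {n : ℕ} (f : SeriesRing R n) (β : ℕ)
    (α : Fin n →₀ ℕ) : R :=
  PowerSeries.coeff β (MvPolynomial.coeff α f)

/-- `t^β x^α` occurs in `f` and has maximal weighted degree among the monomials of `f`. -/
def IsMaximalTerm {R : Type*} [CommRing R] {n : ℕ} (w : Weight n) (f : SeriesRing R n)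
    (β : ℕ) (α : Fin n →₀ ℕ) : Prop :=
  termCoeff f β α ≠ 0 ∧ ∀ (β' : ℕ) (α' : Fin n →₀ ℕ), termCoeff f β' α' ≠ 0 →
    weightedDegree w β' α' ≤ weightedDegree w β α

open Classical in
/-- The initial form `in_w(f) ∈ R[t, x]`, the sum of all terms of `f` of maximal weighted degree.
It is only used for weights `w` with negative first entry, where the sum is finite
(see `coeff_initialForm`). -/
def initialForm {R : Type*} [CommRing R] {n : ℕ} (w : Weight n) (f : SeriesRing R n) :
    PolyRing R n :=
  ∑ᶠ p : ℕ × (Fin n →₀ ℕ),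
    if IsMaximalTerm w f p.1 p.2 then
      MvPolynomial.monomial p.2 (Polynomial.monomial p.1 (termCoeff f p.1 p.2))
    else 0

open Classical in
/-- For weights with negative first entry, the initial form has the expected coefficients. -/
theorem coeff_initialForm {R : Type*} [CommRing R] {n : ℕ} (w : Weight n) (hw : w ∈ openLower n)
    (f : SeriesRing R n) (β : ℕ) (α : Fin n →₀ ℕ) :
    (MvPolynomial.coeff α (initialForm w f)).coeff β =
      if IsMaximalTerm w f β α then termCoeff f β α else 0 := by
  have hfin : {p : ℕ × (Fin n →₀ ℕ) | IsMaximalTerm w f p.1 p.2}.Finite := by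
    refine Set.Finite.of_finite_image (f := Prod.snd)
      (f.support.finite_toSet.subset ?_) ?_
    · rintro _ ⟨p, hp, rfl⟩
      simp only [Finset.mem_coe, MvPolynomial.mem_support_iff]
      intro h0
      exact hp.1 (by simp [termCoeff, h0])
    · rintro ⟨b, a⟩ hp ⟨b', a'⟩ hq (rfl : a = a')
      have h1 := hp.2 b' a hq.1
      have h2 := hq.2 b a hp.1
      have hw' : w.1 < 0 := hw
      simp only [weightedDegree] at h1 h2
      have h3 : w.1 * (b : ℝ) = w.1 * b' := by linarith
      have h4 : (b : ℝ) = b' := mul_left_cancel₀ hw'.ne h3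
      have h5 : b = b' := by exact_mod_cast h4
      rw [h5]
  let L : PolyRing R n →+ R :=
    (Polynomial.lcoeff R β).toAddMonoidHom.comp (MvPolynomial.coeffAddMonoidHom α)
  have hL : ∀ g : PolyRing R n, L g = (MvPolynomial.coeff α g).coeff β := fun g => rfl
  rw [← hL, initialForm, L.map_finsum]
  · rw [finsum_eq_single _ (β, α)]
    · rw [hL]
      split_ifs <;> simp
    · rintro ⟨b, a⟩ hne
      rw [hL]
      split_ifs
      · rw [MvPolynomial.coeff_monomial]
        split_ifs with ha
        · rw [Polynomial.coeff_monomial, if_neg]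
          rintro rfl
          exact hne (Prod.ext rfl ha)
        · simp
      · simp
  · refine hfin.subset fun p hp => ?_
    by_contra hn
    exact hp (if_neg hn)

/-- The initial ideal `in_w(I) = ⟨in_w(f) ∣ f ∈ I⟩ ⊴ R[t, x]`. -/
def initialIdeal {R : Type*} [CommRing R] {n : ℕ} (w : Weight n) (I : Ideal (SeriesRing R n)) :
    Ideal (PolyRing R n) :=
  Ideal.span (initialForm w '' (I : Set (SeriesRing R n)))

/-- An ideal of `R[t, x]` regarded as an ideal of `R⟦t⟧[x]`, namely the ideal it generates. -/
def extend {R : Type*} [CommRing R] {n : ℕ} (J : Ideal (PolyRing R n)) :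
    Ideal (SeriesRing R n) :=
  Ideal.map (polyToSeries R n) J

/-- An ideal of `R⟦t⟧[x]` is `x`-homogeneous if it is generated by elements which are homogeneous
as polynomials in `x` with coefficients in `R⟦t⟧`. -/
def IsXHomogeneous {R : Type*} [CommRing R] {n : ℕ} (I : Ideal (SeriesRing R n)) : Prop :=
  ∃ S : Set (SeriesRing R n), (∀ f ∈ S, ∃ d : ℕ, MvPolynomial.IsHomogeneous f d) ∧
    I = Ideal.span S

/-- The Gröbner cone `C_w(I)`, the closure of `{v ∈ ℝ_{<0} × ℝⁿ ∣ in_v(I) = in_w(I)}`. -/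
def groebnerCone {R : Type*} [CommRing R] {n : ℕ} (w : Weight n) (I : Ideal (SeriesRing R n)) :
    Set (Weight n) :=
  closure {v | v ∈ openLower n ∧ initialIdeal v I = initialIdeal w I}

/-- The homogeneity space `C_0(I)`, the intersection of all `C_w(I)` with `w ∈ ℝ_{<0} × ℝⁿ`. -/
def homogeneitySpace {R : Type*} [CommRing R] {n : ℕ} (I : Ideal (SeriesRing R n)) :
    Set (Weight n) :=
  ⋂ w ∈ openLower n, groebnerCone w I

end GroebnerFan

end

/-!
Write `J = in_w(I)` and let `H` be the set of all weights `v ∈ ℝ × ℝⁿ` for which `J` is homogeneous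
for the `v`-weighted degree. It is a linear subspace (`homogeneityWeights`), and both equalities
are obtained by identifying each of the sets involved with `H ∩ (ℝ_{≤0} × ℝⁿ)`.

If `v` has negative first entry, then `in_v` of the extension of `J` to `R⟦t⟧[x]` equals `J` if and
only if `v ∈ H` (`initialIdeal_extend_eq_iff`). Since `w ∈ H` lies in the open half space, the
closure of these weights is `H ∩ (ℝ_{≤0} × ℝⁿ)` (`closure_inter_openLower`). The homogeneity space
is contained in this closure because the latter is one of the cones that are intersected.
Conversely, if `v ∈ H`, then every initial ideal of the extension of `J` is generated by initial
forms of `v`-homogeneous elements, so that `v + ε u` and `u` give the same initial ideal for all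
`ε > 0`; letting `ε` tend to `0` shows that `v` lies in the cone of `u`
(`closure_subset_groebnerCone`).

It remains to see that `H` is the span of `C_w(I)` (`span_groebnerCone`). Weights with the same
initial ideal as `w` lie in `H` since initial ideals are homogeneous. For `v ∈ H` it suffices
that `u = w + ε v` satisfies `in_u(I) = J` for small `ε` (`eventually_initialIdeal_eq`). As `R` is
noetherian, `J` has finitely many generators which are homogeneous for `w`, `v` and the degree in
`x`; they lift to elements of `I` whose remaining terms are smaller for `w`, hence also for `u` if
`ε` is small. This gives `J ⊆ in_u(I)`. For the other inclusion, the top `u`-component of an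
`x`-homogeneous `f ∈ I` is shown to lie in `J` by descent on the `w`-degree of `f`
(`homPart_mem_of_liftable`): subtracting a lift of `in_w(f) ∈ J` lowers this degree and
changes the top `u`-component only by an element of `J`. The descent is finite because only finitely
many monomials of given degree in `x` have `w`-degree above a given bound; this is where
`x`-homogeneity enters.
-/

noncomputable section

namespace GroebnerFan

variable {R : Type*} [CommRing R] {n : ℕ}

local notation "ι" => polyToSeries _ _

/-! ### Weighted degrees and the terms of a series -/

/-- The weighted degree as an additive map on exponents `(β, α)` of monomials `t^β x^α`. -/
def deg (v : Weight n) : ℕ × (Fin n →₀ ℕ) →+ ℝ where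
  toFun m := weightedDegree v m.1 m.2
  map_zero' := by simp [weightedDegree]
  map_add' a b := by
    simp only [weightedDegree, Prod.fst_add, Prod.snd_add, Finsupp.add_apply, Nat.cast_add,
      mul_add, Finset.sum_add_distrib]
    ring

theorem deg_apply (v : Weight n) (m : ℕ × (Fin n →₀ ℕ)) :
    deg v m = v.1 * m.1 + ∑ i, v.2 i * m.2 i := rfl

theorem deg_add_weight (v u : Weight n) (m : ℕ × (Fin n →₀ ℕ)) :
    deg (v + u) m = deg v m + deg u m := by
  simp only [deg_apply, Prod.fst_add, Prod.snd_add, Pi.add_apply, add_mul, Finset.sum_add_distrib]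
  ring

theorem deg_smul_weight (c : ℝ) (v : Weight n) (m : ℕ × (Fin n →₀ ℕ)) :
    deg (c • v) m = c * deg v m := by
  simp only [deg_apply, Prod.smul_fst, Prod.smul_snd, Pi.smul_apply, smul_eq_mul, mul_add,
    Finset.mul_sum, mul_assoc]

/-- The exponents `(β, α)` of the monomials `t^β x^α` which occur in `f`. -/
def terms (f : SeriesRing R n) : Set (ℕ × (Fin n →₀ ℕ)) := {m | termCoeff f m.1 m.2 ≠ 0}

theorem mem_terms {f : SeriesRing R n} {m : ℕ × (Fin n →₀ ℕ)} :
    m ∈ terms f ↔ termCoeff f m.1 m.2 ≠ 0 := Iff.rfl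

/-- `termCoeff` as an additive map. -/
def termCoeffHom (β : ℕ) (α : Fin n →₀ ℕ) : SeriesRing R n →+ R :=
  (PowerSeries.coeff (R := R) β).toAddMonoidHom.comp (MvPolynomial.coeffAddMonoidHom α)

theorem termCoeff_zero (β : ℕ) (α : Fin n →₀ ℕ) : termCoeff (0 : SeriesRing R n) β α = 0 :=
  map_zero (termCoeffHom β α)

theorem termCoeff_add (f g : SeriesRing R n) (β : ℕ) (α : Fin n →₀ ℕ) :
    termCoeff (f + g) β α = termCoeff f β α + termCoeff g β α :=
  map_add (termCoeffHom β α) f g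

theorem termCoeff_sub (f g : SeriesRing R n) (β : ℕ) (α : Fin n →₀ ℕ) :
    termCoeff (f - g) β α = termCoeff f β α - termCoeff g β α :=
  map_sub (termCoeffHom β α) f g

theorem termCoeff_sum {κ : Type*} (s : Finset κ) (f : κ → SeriesRing R n) (β : ℕ)
    (α : Fin n →₀ ℕ) : termCoeff (∑ i ∈ s, f i) β α = ∑ i ∈ s, termCoeff (f i) β α :=
  map_sum (termCoeffHom β α) f s

theorem termCoeff_mul (f g : SeriesRing R n) (β : ℕ) (α : Fin n →₀ ℕ) :
    termCoeff (f * g) β α = ∑ x ∈ Finset.HasAntidiagonal.antidiagonal α,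
      ∑ y ∈ Finset.HasAntidiagonal.antidiagonal β,
        termCoeff f y.1 x.1 * termCoeff g y.2 x.2 := by
  classical
  simp only [termCoeff, MvPolynomial.coeff_mul, map_sum, PowerSeries.coeff_mul]

theorem ext_termCoeff {f g : SeriesRing R n}
    (h : ∀ m : ℕ × (Fin n →₀ ℕ), termCoeff f m.1 m.2 = termCoeff g m.1 m.2) : f = g := by
  ext α β
  exact h (β, α)

theorem termCoeff_polyToSeries (p : PolyRing R n) (β : ℕ) (α : Fin n →₀ ℕ) :
    termCoeff (polyToSeries R n p) β α = (MvPolynomial.coeff α p).coeff β := by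
  simp [termCoeff, polyToSeries, MvPolynomial.coeff_map]

theorem polyToSeries_injective : Function.Injective (polyToSeries R n) :=
  MvPolynomial.map_injective _ (Polynomial.coe_injective R)

theorem ext_poly {p q : PolyRing R n}
    (h : ∀ m : ℕ × (Fin n →₀ ℕ), termCoeff (ι p) m.1 m.2 = termCoeff (ι q) m.1 m.2) : p = q :=
  polyToSeries_injective (ext_termCoeff h)

theorem eq_zero_of_terms_eq_empty {f : SeriesRing R n} (h : terms f = ∅) : f = 0 := by
  refine ext_termCoeff fun m => ?_
  by_contra hm
  rw [termCoeff_zero] at hm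
  have : m ∈ terms f := hm
  simp [h] at this

theorem terms_zero : terms (0 : SeriesRing R n) = ∅ := by
  ext m
  simp [mem_terms, termCoeff_zero]

theorem mem_terms_add {f g : SeriesRing R n} {m : ℕ × (Fin n →₀ ℕ)} (h : m ∈ terms (f + g)) :
    m ∈ terms f ∨ m ∈ terms g := by
  by_contra! hc
  simp only [mem_terms, not_not] at hc
  exact h (by rw [termCoeff_add, hc.1, hc.2, add_zero])

theorem mem_terms_sub {f g : SeriesRing R n} {m : ℕ × (Fin n →₀ ℕ)} (h : m ∈ terms (f - g)) :
    m ∈ terms f ∨ m ∈ terms g := by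
  by_contra! hc
  simp only [mem_terms, not_not] at hc
  exact h (by rw [termCoeff_sub, hc.1, hc.2, sub_zero])

theorem mem_terms_mul {f g : SeriesRing R n} {m : ℕ × (Fin n →₀ ℕ)} (h : m ∈ terms (f * g)) :
    ∃ a ∈ terms f, ∃ b ∈ terms g, a + b = m := by
  rw [mem_terms, termCoeff_mul] at h
  obtain ⟨x, hx, h⟩ := Finset.exists_ne_zero_of_sum_ne_zero h
  obtain ⟨y, hy, h⟩ := Finset.exists_ne_zero_of_sum_ne_zero h
  rw [Finset.HasAntidiagonal.mem_antidiagonal] at hx hy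
  exact ⟨(y.1, x.1), left_ne_zero_of_mul h, (y.2, x.2), right_ne_zero_of_mul h, Prod.ext hy hx⟩

theorem finite_terms_polyToSeries (p : PolyRing R n) : (terms (ι p)).Finite := by
  refine (p.support.finite_toSet.biUnion (t := fun α =>
    (fun β => (β, α)) '' ((MvPolynomial.coeff α p).support : Set ℕ))
    fun α _ => (Finset.finite_toSet _).image _).subset ?_
  rintro ⟨β, α⟩ h
  rw [mem_terms, termCoeff_polyToSeries] at h
  simp only [Set.mem_iUnion]
  refine ⟨α, ?_, β, by simpa using h, rfl⟩
  simp only [Finset.mem_coe, MvPolynomial.mem_support_iff]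
  rintro h0
  simp [h0] at h

theorem snd_mem_support {f : SeriesRing R n} {m : ℕ × (Fin n →₀ ℕ)} (h : m ∈ terms f) :
    m.2 ∈ f.support := by
  rw [MvPolynomial.mem_support_iff]
  intro h0
  exact h (by simp [termCoeff, h0])

/-- If `t` has negative weight and the exponent of `x` ranges over a finite set, then only
finitely many monomials have weighted degree at least `c`. -/
theorem finite_le_deg {v : Weight n} (hv : v ∈ openLower n) {A : Set (Fin n →₀ ℕ)}
    (hA : A.Finite) (c : ℝ) : {m : ℕ × (Fin n →₀ ℕ) | m.2 ∈ A ∧ c ≤ deg v m}.Finite := by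
  have hv' : v.1 < 0 := hv
  refine (hA.biUnion (t := fun α => (fun β => (β, α)) ''
    (Set.Iic ⌊(c - ∑ i, v.2 i * α i) / v.1⌋₊ : Set ℕ))
    fun α _ => (Set.finite_Iic _).image _).subset ?_
  rintro ⟨β, α⟩ ⟨hα, h⟩
  simp only [Set.mem_iUnion]
  refine ⟨α, hα, β, Nat.le_floor ?_, rfl⟩
  rw [le_div_iff_of_neg hv']
  simp only [deg_apply] at h
  linarith

theorem finite_deg_eq {v : Weight n} (hv : v ∈ openLower n) (D : ℝ) (f : SeriesRing R n) :
    ({m | deg v m = D} ∩ terms f).Finite :=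
  (finite_le_deg hv f.support.finite_toSet D).subset fun _ hm =>
    ⟨snd_mem_support hm.2, (hm.1 : deg v _ = D).ge⟩

/-! ### Parts of a series -/

open Classical in
/-- The sum of those terms of `f` whose exponent lies in `M`, as an element of `R[t, x]`. It is
only meaningful if this sum is finite; the junk value is `0` otherwise. -/
def part (M : Set (ℕ × (Fin n →₀ ℕ))) (f : SeriesRing R n) : PolyRing R n :=
  ∑ᶠ m : ℕ × (Fin n →₀ ℕ),
    if m ∈ M then
      MvPolynomial.monomial m.2 (Polynomial.monomial m.1 (termCoeff f m.1 m.2))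
    else 0

open Classical in
theorem termCoeff_part {M : Set (ℕ × (Fin n →₀ ℕ))} {f : SeriesRing R n}
    (hfin : (M ∩ terms f).Finite) (m : ℕ × (Fin n →₀ ℕ)) :
    termCoeff (ι (part M f)) m.1 m.2 = if m ∈ M then termCoeff f m.1 m.2 else 0 := by
  let L : PolyRing R n →+ R := (termCoeffHom m.1 m.2).comp (polyToSeries R n).toAddMonoidHom
  have hL : ∀ g : PolyRing R n, L g = (MvPolynomial.coeff m.2 g).coeff m.1 := fun g =>
    termCoeff_polyToSeries g m.1 m.2
  change L (part M f) = _
  rw [part, L.map_finsum]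
  · rw [finsum_eq_single _ m]
    · rw [hL]
      split_ifs <;> simp
    · rintro ⟨b, a⟩ hne
      rw [hL]
      split_ifs
      · rw [MvPolynomial.coeff_monomial]
        split_ifs with ha
        · rw [Polynomial.coeff_monomial, if_neg]
          rintro rfl
          exact hne (Prod.ext rfl ha)
        · simp
      · simp
  · refine hfin.subset fun p hp => ?_
    rw [Function.mem_support] at hp
    refine ⟨by_contra fun hn => hp (if_neg hn), fun h0 => hp ?_⟩
    simp [h0]

/-- The component of `f` of `v`-weighted degree `D`, as an element of `R[t, x]`. The sum is finite
if `t` has negative weight, and for all weights if `f` is a polynomial. -/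
def homPart (v : Weight n) (D : ℝ) (f : SeriesRing R n) : PolyRing R n :=
  part {m | deg v m = D} f

open Classical in
theorem termCoeff_homPart {v : Weight n} (hv : v ∈ openLower n) (D : ℝ) (f : SeriesRing R n)
    (m : ℕ × (Fin n →₀ ℕ)) :
    termCoeff (ι (homPart v D f)) m.1 m.2 = if deg v m = D then termCoeff f m.1 m.2 else 0 :=
  termCoeff_part (finite_deg_eq hv D f) m

theorem finite_inter_terms_poly (M : Set (ℕ × (Fin n →₀ ℕ))) (p : PolyRing R n) :
    (M ∩ terms (ι p)).Finite := (finite_terms_polyToSeries p).subset Set.inter_subset_right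

open Classical in
theorem termCoeff_part_poly (M : Set (ℕ × (Fin n →₀ ℕ))) (p : PolyRing R n)
    (m : ℕ × (Fin n →₀ ℕ)) :
    termCoeff (ι (part M (ι p))) m.1 m.2 = if m ∈ M then termCoeff (ι p) m.1 m.2 else 0 :=
  termCoeff_part (finite_inter_terms_poly M p) m

open Classical in
theorem termCoeff_homPart_poly (v : Weight n) (D : ℝ) (p : PolyRing R n)
    (m : ℕ × (Fin n →₀ ℕ)) :
    termCoeff (ι (homPart v D (ι p))) m.1 m.2 = if deg v m = D then termCoeff (ι p) m.1 m.2 else 0 :=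
  termCoeff_part_poly _ p m

theorem mem_terms_part {M : Set (ℕ × (Fin n →₀ ℕ))} {f : SeriesRing R n}
    (hfin : (M ∩ terms f).Finite) {m : ℕ × (Fin n →₀ ℕ)} :
    m ∈ terms (ι (part M f)) ↔ m ∈ M ∧ m ∈ terms f := by
  classical
  rw [mem_terms, termCoeff_part hfin, mem_terms]
  split_ifs with h <;> simp [h]

theorem mem_terms_part_poly {M : Set (ℕ × (Fin n →₀ ℕ))} {p : PolyRing R n}
    {m : ℕ × (Fin n →₀ ℕ)} : m ∈ terms (ι (part M (ι p))) ↔ m ∈ M ∧ m ∈ terms (ι p) :=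
  mem_terms_part (finite_inter_terms_poly M p)

theorem part_add {M : Set (ℕ × (Fin n →₀ ℕ))} {f g : SeriesRing R n}
    (hf : (M ∩ terms f).Finite) (hg : (M ∩ terms g).Finite) :
    part M (f + g) = part M f + part M g := by
  classical
  have hfg : (M ∩ terms (f + g)).Finite := (hf.union hg).subset fun m hm =>
    (mem_terms_add hm.2).imp (fun h => ⟨hm.1, h⟩) (fun h => ⟨hm.1, h⟩)
  refine ext_poly fun m => ?_
  rw [map_add, termCoeff_add, termCoeff_part hf, termCoeff_part hg, termCoeff_part hfg,
    termCoeff_add]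
  split_ifs <;> simp

theorem part_poly_add (M : Set (ℕ × (Fin n →₀ ℕ))) (p q : PolyRing R n) :
    part M (ι (p + q)) = part M (ι p) + part M (ι q) := by
  rw [map_add]
  exact part_add (finite_inter_terms_poly M p) (finite_inter_terms_poly M q)

theorem part_zero (M : Set (ℕ × (Fin n →₀ ℕ))) : part M (0 : SeriesRing R n) = 0 := by
  simp [part, termCoeff_zero]

theorem homPart_add {v : Weight n} (hv : v ∈ openLower n) (D : ℝ) (f g : SeriesRing R n) :
    homPart v D (f + g) = homPart v D f + homPart v D g :=
  part_add (finite_deg_eq hv D f) (finite_deg_eq hv D g)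

theorem homPart_sum {v : Weight n} (hv : v ∈ openLower n) (D : ℝ) {κ : Type*} (s : Finset κ)
    (f : κ → SeriesRing R n) : homPart v D (∑ i ∈ s, f i) = ∑ i ∈ s, homPart v D (f i) :=
  map_sum (AddMonoidHom.mk' (homPart v D) (homPart_add hv D)) f s

theorem part_poly_sum (M : Set (ℕ × (Fin n →₀ ℕ))) {κ : Type*} (s : Finset κ)
    (p : κ → PolyRing R n) : part M (ι (∑ i ∈ s, p i)) = ∑ i ∈ s, part M (ι (p i)) :=
  map_sum (AddMonoidHom.mk' (fun q : PolyRing R n => part M (ι q)) (part_poly_add M)) p s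

/-- Taking parts commutes with multiplication by a polynomial `h` all of whose terms shift the set
`M'` onto the set `M` in the same way, for instance a homogeneous one. -/
theorem part_mul {M M' : Set (ℕ × (Fin n →₀ ℕ))} {a : SeriesRing R n} {h : PolyRing R n}
    (hM : ∀ m, ∀ m' ∈ terms (ι h), m + m' ∈ M ↔ m ∈ M')
    (h₁ : (M ∩ terms (a * ι h)).Finite) (h₂ : (M' ∩ terms a).Finite) :
    part M (a * ι h) = part M' a * h := by
  classical
  refine ext_poly fun m => ?_
  have key : ∀ a₁ b₁ : ℕ × (Fin n →₀ ℕ), a₁ + b₁ = m →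
      (if m ∈ M then termCoeff a a₁.1 a₁.2 * termCoeff (ι h) b₁.1 b₁.2 else 0) =
        termCoeff (ι (part M' a)) a₁.1 a₁.2 * termCoeff (ι h) b₁.1 b₁.2 := by
    rintro a₁ b₁ rfl
    rw [termCoeff_part h₂]
    by_cases hb : termCoeff (ι h) b₁.1 b₁.2 = 0
    · simp [hb]
    · simp [hM a₁ b₁ hb]
  rw [map_mul, termCoeff_part h₁, termCoeff_mul, termCoeff_mul, ← Finset.sum_const_zero,
    ← Finset.sum_ite_irrel]
  refine Finset.sum_congr rfl fun x hx => ?_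
  rw [← Finset.sum_const_zero, ← Finset.sum_ite_irrel]
  refine Finset.sum_congr rfl fun y hy => ?_
  rw [Finset.HasAntidiagonal.mem_antidiagonal] at hx hy
  exact key (y.1, x.1) (y.2, x.2) (Prod.ext hy hx)

/-! ### Homogeneous elements and ideals -/

/-- All terms of `f` have `v`-weighted degree `D`. -/
def IsWeightHomogeneous (v : Weight n) (D : ℝ) (f : SeriesRing R n) : Prop :=
  ∀ m ∈ terms f, deg v m = D

theorem isWeightHomogeneous_homPart {v : Weight n} (hv : v ∈ openLower n) (D : ℝ)
    (f : SeriesRing R n) : IsWeightHomogeneous v D (ι (homPart v D f)) := fun _ hm =>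
  ((mem_terms_part (finite_deg_eq hv D f)).1 hm).1

theorem isWeightHomogeneous_homPart_poly (v : Weight n) (D : ℝ) (p : PolyRing R n) :
    IsWeightHomogeneous v D (ι (homPart v D (ι p))) := fun _ hm =>
  (mem_terms_part_poly.1 hm).1

theorem homPart_mul {v : Weight n} (hv : v ∈ openLower n) (D : ℝ) {e : ℝ} (a : SeriesRing R n)
    {h : PolyRing R n} (hh : IsWeightHomogeneous v e (ι h)) :
    homPart v D (a * ι h) = homPart v (D - e) a * h :=
  part_mul (fun m m' hm' => by
    simp only [Set.mem_ofPred_eq, map_add, hh m' hm', eq_sub_iff_add_eq])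
    (finite_deg_eq hv _ _) (finite_deg_eq hv _ _)

theorem part_mul_poly {M M' : Set (ℕ × (Fin n →₀ ℕ))} {a h : PolyRing R n}
    (hM : ∀ m, ∀ m' ∈ terms (ι h), m + m' ∈ M ↔ m ∈ M') :
    part M (ι (a * h)) = part M' (ι a) * h := by
  have h₁ := finite_inter_terms_poly M (a * h)
  rw [map_mul] at h₁ ⊢
  exact part_mul hM h₁ (finite_inter_terms_poly _ _)

theorem homPart_mul_poly {v : Weight n} (D : ℝ) {e : ℝ} (a : PolyRing R n)
    {h : PolyRing R n} (hh : IsWeightHomogeneous v e (ι h)) :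
    homPart v D (ι (a * h)) = homPart v (D - e) (ι a) * h :=
  part_mul_poly fun m m' hm' => by
    simp only [Set.mem_ofPred_eq, map_add, hh m' hm', eq_sub_iff_add_eq]

/-- A polynomial is the sum of its parts with respect to any map on the exponents. -/
theorem exists_eq_sum_part {G : Type*} (δ : ℕ × (Fin n →₀ ℕ) → G) (p : PolyRing R n) :
    ∃ S : Finset G, p = ∑ g ∈ S, part {m | δ m = g} (ι p) := by
  classical
  refine ⟨(finite_terms_polyToSeries p).toFinset.image δ, ext_poly fun m => ?_⟩
  rw [map_sum, termCoeff_sum]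
  simp only [termCoeff_part_poly, Set.mem_ofPred_eq]
  rw [Finset.sum_ite_eq]
  split_ifs with h
  · rfl
  · by_contra hm
    exact h (Finset.mem_image_of_mem _ (by simpa [mem_terms] using hm))

/-- An ideal of `R[t, x]` which is homogeneous for the `v`-weighted degree. -/
def IsHomogeneousFor (v : Weight n) (J : Ideal (PolyRing R n)) : Prop :=
  ∀ p ∈ J, ∀ D, homPart v D (ι p) ∈ J

theorem isHomogeneousFor_span {v : Weight n} {G : Set (PolyRing R n)}
    (hG : ∀ g ∈ G, ∃ e, IsWeightHomogeneous v e (ι g)) : IsHomogeneousFor v (Ideal.span G) := by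
  intro p hp
  induction hp using Submodule.closure_induction with
  | zero => intro D; simp [homPart, part_zero]
  | add p q _ _ hp hq =>
    intro D
    rw [homPart, part_poly_add]
    exact add_mem (hp D) (hq D)
  | smul_mem a g hg =>
    intro D
    obtain ⟨e, he⟩ := hG g hg
    rw [smul_eq_mul, homPart_mul_poly D a he]
    exact Ideal.mul_mem_left _ _ (Ideal.subset_span hg)

/-- The weights for which a fixed ideal of `R[t, x]` is homogeneous form a linear subspace. -/
def homogeneityWeights (J : Ideal (PolyRing R n)) : Submodule ℝ (Weight n) where
  carrier := {v | IsHomogeneousFor v J}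
  zero_mem' := by
    intro p hp D
    have h0 : ∀ m, deg (0 : Weight n) m = 0 := fun m => by simp [deg_apply]
    by_cases hD : (0 : ℝ) = D
    · convert hp
      refine ext_poly fun m => ?_
      classical
      rw [termCoeff_homPart_poly, if_pos ((h0 m).trans hD)]
    · convert J.zero_mem
      refine ext_poly fun m => ?_
      classical
      rw [termCoeff_homPart_poly, if_neg fun h => hD ((h0 m).symm.trans h), map_zero,
        termCoeff_zero]
  add_mem' := by
    intro v u hv hu p hp D
    obtain ⟨S, hS⟩ := exists_eq_sum_part (deg v) p
    rw [hS, homPart, part_poly_sum]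
    refine sum_mem fun s _ => ?_
    convert hu _ (hv p hp s) (D - s) using 1
    refine ext_poly fun m => ?_
    classical
    rw [termCoeff_homPart_poly, termCoeff_homPart_poly]
    change termCoeff (ι (homPart (v + u) D (ι (homPart v s (ι p))))) m.1 m.2 = _
    rw [termCoeff_homPart_poly, termCoeff_homPart_poly]
    by_cases h : deg v m = s
    · simp [deg_add_weight, h, eq_sub_iff_add_eq']
    · simp [h]
  smul_mem' := by
    intro c v hv p hp D
    obtain ⟨S, hS⟩ := exists_eq_sum_part (deg v) p
    rw [hS, homPart, part_poly_sum]
    refine sum_mem fun s _ => ?_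
    by_cases hs : c * s = D
    · convert hv p hp s using 1
      refine ext_poly fun m => ?_
      classical
      rw [homPart, termCoeff_part_poly, termCoeff_part_poly]
      simp only [Set.mem_ofPred_eq, deg_smul_weight]
      by_cases h : deg v m = s
      · simp [h, hs]
      · simp [h]
    · convert J.zero_mem
      refine ext_poly fun m => ?_
      classical
      rw [termCoeff_part_poly, termCoeff_part_poly, map_zero, termCoeff_zero]
      simp only [Set.mem_ofPred_eq, deg_smul_weight]
      by_cases h : deg v m = s
      · simp [h, hs]
      · simp [h]

/-! ### Initial forms and initial ideals -/

theorem exists_top_degree {v : Weight n} (hv : v ∈ openLower n) {f : SeriesRing R n}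
    (hf : f ≠ 0) : ∃ m ∈ terms f, ∀ m' ∈ terms f, deg v m' ≤ deg v m := by
  obtain ⟨m₀, hm₀⟩ : (terms f).Nonempty :=
    Set.nonempty_iff_ne_empty.2 fun h => hf (eq_zero_of_terms_eq_empty h)
  have hfin : {m | m ∈ terms f ∧ deg v m₀ ≤ deg v m}.Finite :=
    (finite_le_deg hv f.support.finite_toSet (deg v m₀)).subset fun m hm =>
      ⟨snd_mem_support hm.1, hm.2⟩
  obtain ⟨m, hm, hmax⟩ := Set.exists_max_image _ (deg v) hfin ⟨m₀, hm₀, le_rfl⟩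
  refine ⟨m, hm.1, fun m' hm' => ?_⟩
  rcases le_total (deg v m₀) (deg v m') with h | h
  · exact hmax m' ⟨hm', h⟩
  · exact h.trans hm.2

theorem initialForm_eq_homPart {v : Weight n} (hv : v ∈ openLower n) {f : SeriesRing R n}
    {m : ℕ × (Fin n →₀ ℕ)} (hm : m ∈ terms f) (hmax : ∀ m' ∈ terms f, deg v m' ≤ deg v m) :
    initialForm v f = homPart v (deg v m) f := by
  classical
  refine ext_poly fun a => ?_
  rw [termCoeff_homPart hv, termCoeff_polyToSeries, coeff_initialForm v hv]
  by_cases ha : a ∈ terms f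
  · have : IsMaximalTerm v f a.1 a.2 ↔ deg v a = deg v m :=
      ⟨fun h => le_antisymm (hmax a ha) (h.2 m.1 m.2 hm),
        fun h => ⟨ha, fun β α hβα => (hmax (β, α) hβα).trans h.ge⟩⟩
    simp only [this]
  · rw [mem_terms, not_not] at ha
    simp [ha]

theorem initialForm_zero {v : Weight n} (hv : v ∈ openLower n) :
    initialForm v (0 : SeriesRing R n) = 0 := by
  classical
  refine ext_poly fun a => ?_
  rw [termCoeff_polyToSeries, coeff_initialForm v hv]
  simp [termCoeff_zero]

/-- If `D` bounds the weighted degrees of the terms of `f`, then the component of degree `D` is the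
initial form, or it vanishes because the bound is not attained. -/
theorem homPart_eq_zero_or {v : Weight n} (hv : v ∈ openLower n) {f : SeriesRing R n}
    {D : ℝ} (hD : ∀ m ∈ terms f, deg v m ≤ D) :
    homPart v D f = 0 ∨ homPart v D f = initialForm v f := by
  by_cases h : ∃ m ∈ terms f, deg v m = D
  · obtain ⟨m, hm, rfl⟩ := h
    exact Or.inr (initialForm_eq_homPart hv hm hD).symm
  · classical
    refine Or.inl (ext_poly fun a => ?_)
    rw [termCoeff_homPart hv, map_zero, termCoeff_zero, ite_eq_right_iff]
    intro ha
    by_contra hne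
    exact h ⟨a, hne, ha⟩

theorem homPart_eq_zero {v : Weight n} (hv : v ∈ openLower n) {f : SeriesRing R n}
    {D : ℝ} (hD : ∀ m ∈ terms f, deg v m < D) : homPart v D f = 0 := by
  classical
  refine ext_poly fun a => ?_
  rw [termCoeff_homPart hv, map_zero, termCoeff_zero, ite_eq_right_iff]
  intro ha
  by_contra hne
  exact (hD a hne).ne ha

theorem homPart_mem_initialIdeal {v : Weight n} (hv : v ∈ openLower n)
    {I : Ideal (SeriesRing R n)} {f : SeriesRing R n} (hf : f ∈ I) {D : ℝ}
    (hD : ∀ m ∈ terms f, deg v m ≤ D) : homPart v D f ∈ initialIdeal v I := by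
  rcases homPart_eq_zero_or hv hD with h | h
  · rw [h]; exact zero_mem _
  · rw [h]; exact Ideal.subset_span ⟨f, hf, rfl⟩

theorem initialForm_mem_of_homPart_mem {v : Weight n} (hv : v ∈ openLower n)
    {f : SeriesRing R n} {J : Ideal (PolyRing R n)}
    (h : ∀ D, (∀ m ∈ terms f, deg v m ≤ D) → homPart v D f ∈ J) : initialForm v f ∈ J := by
  by_cases hf : f = 0
  · rw [hf, initialForm_zero hv]; exact zero_mem _
  · obtain ⟨m, hm, hmax⟩ := exists_top_degree hv hf
    rw [initialForm_eq_homPart hv hm hmax]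
    exact h _ hmax

theorem initialIdeal_le {v : Weight n} (hv : v ∈ openLower n) {I : Ideal (SeriesRing R n)}
    {J : Ideal (PolyRing R n)}
    (h : ∀ f ∈ I, ∀ D, (∀ m ∈ terms f, deg v m ≤ D) → homPart v D f ∈ J) :
    initialIdeal v I ≤ J := by
  rw [initialIdeal, Ideal.span_le]
  rintro _ ⟨f, hf, rfl⟩
  exact initialForm_mem_of_homPart_mem hv (h f hf)

theorem exists_isWeightHomogeneous_initialForm {v : Weight n} (hv : v ∈ openLower n)
    (f : SeriesRing R n) : ∃ D, IsWeightHomogeneous v D (ι (initialForm v f)) := by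
  by_cases hf : f = 0
  · refine ⟨0, fun m hm => ?_⟩
    rw [hf, initialForm_zero hv, map_zero, terms_zero] at hm
    exact hm.elim
  · obtain ⟨m, hm, hmax⟩ := exists_top_degree hv hf
    rw [initialForm_eq_homPart hv hm hmax]
    exact ⟨_, isWeightHomogeneous_homPart hv _ _⟩

theorem isHomogeneousFor_initialIdeal {v : Weight n} (hv : v ∈ openLower n)
    (I : Ideal (SeriesRing R n)) : IsHomogeneousFor v (initialIdeal v I) := by
  refine isHomogeneousFor_span ?_
  rintro _ ⟨f, -, rfl⟩
  exact exists_isWeightHomogeneous_initialForm hv f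

theorem homPart_self {v : Weight n} {D : ℝ} {p : PolyRing R n}
    (hp : IsWeightHomogeneous v D (ι p)) : homPart v D (ι p) = p := by
  classical
  refine ext_poly fun m => ?_
  rw [homPart, termCoeff_part_poly, Set.mem_ofPred_eq, ite_eq_left_iff]
  intro h
  by_contra hne
  exact h (hp m (Ne.symm hne))

/-! ### Initial ideals of extended ideals -/

theorem polyToSeries_mem_extend {J : Ideal (PolyRing R n)} {p : PolyRing R n} (hp : p ∈ J) :
    ι p ∈ extend J := Ideal.mem_map_of_mem _ hp

theorem homPart_mem_of_mem_extend {v : Weight n} (hv : v ∈ openLower n)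
    {J : Ideal (PolyRing R n)} (hJ : IsHomogeneousFor v J) {f : SeriesRing R n}
    (hf : f ∈ extend J) (D : ℝ) : homPart v D f ∈ J := by
  rw [extend, Ideal.map] at hf
  induction hf using Submodule.closure_induction with
  | zero => simp [homPart, part_zero]
  | add f g _ _ hf hg =>
    rw [homPart_add hv]
    exact add_mem hf hg
  | smul_mem a g hg =>
    obtain ⟨p, hp, rfl⟩ := hg
    obtain ⟨S, hS⟩ := exists_eq_sum_part (deg v) p
    rw [hS, map_sum, smul_eq_mul, Finset.mul_sum, homPart_sum hv]
    refine sum_mem fun s _ => ?_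
    have := isWeightHomogeneous_homPart_poly v s p
    rw [homPart] at this
    rw [homPart_mul hv D a this]
    exact Ideal.mul_mem_left _ _ (hJ p hp s)

theorem initialIdeal_extend {v : Weight n} (hv : v ∈ openLower n)
    {J : Ideal (PolyRing R n)} (hJ : IsHomogeneousFor v J) : initialIdeal v (extend J) = J := by
  refine le_antisymm
    (initialIdeal_le hv fun f hf D _ => homPart_mem_of_mem_extend hv hJ hf D) fun p hp => ?_
  obtain ⟨S, hS⟩ := exists_eq_sum_part (deg v) p
  rw [hS]
  refine sum_mem fun s _ => ?_
  have hs := isWeightHomogeneous_homPart_poly v s p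
  change homPart v s (ι p) ∈ _
  rw [← homPart_self hs]
  exact homPart_mem_initialIdeal hv (polyToSeries_mem_extend (hJ p hp s)) fun m hm => (hs m hm).le

theorem initialIdeal_extend_eq_iff {v : Weight n} (hv : v ∈ openLower n)
    (J : Ideal (PolyRing R n)) : initialIdeal v (extend J) = J ↔ v ∈ homogeneityWeights J :=
  ⟨fun h => by
    have := isHomogeneousFor_initialIdeal hv (extend J)
    rwa [h] at this, initialIdeal_extend hv⟩

/-- If `J` is `v`-homogeneous, then every initial ideal of its extension is generated by the
initial forms of the `v`-homogeneous elements of `J`. -/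
theorem initialIdeal_extend_eq_span {v u : Weight n} (hv : v ∈ openLower n)
    (hu : u ∈ openLower n) {J : Ideal (PolyRing R n)} (hJ : IsHomogeneousFor v J) :
    initialIdeal u (extend J) = Ideal.span
      ((fun g : PolyRing R n => initialForm u (ι g)) ''
        {g | g ∈ J ∧ ∃ s, IsWeightHomogeneous v s (ι g)}) := by
  apply le_antisymm
  · refine initialIdeal_le hu fun f hf D hD => ?_
    obtain ⟨S, hS⟩ := exists_eq_sum_part (deg v) (homPart u D f)
    rw [hS]
    refine sum_mem fun s _ => ?_
    have hcomm : part {m | deg v m = s} (ι (homPart u D f)) =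
        homPart u D (ι (homPart v s f)) := by
      classical
      refine ext_poly fun m => ?_
      rw [termCoeff_part_poly, termCoeff_homPart hu, termCoeff_homPart hu, termCoeff_homPart hv]
      simp only [Set.mem_ofPred_eq]
      split_ifs <;> rfl
    have hbound : ∀ m ∈ terms (ι (homPart v s f)), deg u m ≤ D := fun m hm =>
      hD m ((mem_terms_part (finite_deg_eq hv s f)).1 hm).2
    rw [hcomm]
    rcases homPart_eq_zero_or hu hbound with h | h
    · rw [h]; exact zero_mem _
    · rw [h]
      exact Ideal.subset_span ⟨_, ⟨homPart_mem_of_mem_extend hv hJ hf s, s,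
        isWeightHomogeneous_homPart hv s f⟩, rfl⟩
  · rw [Ideal.span_le]
    rintro _ ⟨g, ⟨hg, -⟩, rfl⟩
    exact Ideal.subset_span ⟨_, polyToSeries_mem_extend hg, rfl⟩

/-- On elements all of whose terms have the same `v`-weighted degree, the weights `u` and `v + c u`
with `c > 0` order the terms in the same way. -/
theorem initialForm_add_smul {v u : Weight n} (hu : u ∈ openLower n) {c : ℝ} (hc : 0 < c)
    (hvu : v + c • u ∈ openLower n) {s : ℝ} {f : SeriesRing R n}
    (hf : IsWeightHomogeneous v s f) : initialForm (v + c • u) f = initialForm u f := by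
  by_cases h0 : f = 0
  · rw [h0, initialForm_zero hu, initialForm_zero hvu]
  obtain ⟨m, hm, hmax⟩ := exists_top_degree hu h0
  have hdeg : ∀ a ∈ terms f, deg (v + c • u) a = s + c * deg u a := fun a ha => by
    rw [deg_add_weight, deg_smul_weight, hf a ha]
  have hmax' : ∀ a ∈ terms f, deg (v + c • u) a ≤ deg (v + c • u) m := fun a ha => by
    rw [hdeg a ha, hdeg m hm]
    have := mul_le_mul_of_nonneg_left (hmax a ha) hc.le
    linarith
  rw [initialForm_eq_homPart hu hm hmax, initialForm_eq_homPart hvu hm hmax']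
  classical
  refine ext_poly fun a => ?_
  rw [termCoeff_homPart hu, termCoeff_homPart hvu]
  by_cases ha : a ∈ terms f
  · simp only [hdeg a ha, hdeg m hm, add_right_inj, mul_right_inj' hc.ne']
  · rw [mem_terms, not_not] at ha
    simp [ha]

theorem initialIdeal_extend_add_smul {v u : Weight n} (hv : v ∈ openLower n)
    (hu : u ∈ openLower n) {c : ℝ} (hc : 0 < c) (hvu : v + c • u ∈ openLower n)
    {J : Ideal (PolyRing R n)} (hJ : IsHomogeneousFor v J) :
    initialIdeal (v + c • u) (extend J) = initialIdeal u (extend J) := by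
  rw [initialIdeal_extend_eq_span hv hvu hJ, initialIdeal_extend_eq_span hv hu hJ]
  congr 1
  refine Set.image_congr ?_
  rintro g ⟨-, s, hs⟩
  exact initialForm_add_smul hu hc hvu hs

/-! ### Homogeneity in `x` -/

theorem mem_terms_sum {κ : Type*} {s : Finset κ} {f : κ → SeriesRing R n}
    {m : ℕ × (Fin n →₀ ℕ)} (h : m ∈ terms (∑ i ∈ s, f i)) : ∃ i ∈ s, m ∈ terms (f i) := by
  rw [mem_terms, termCoeff_sum] at h
  exact Finset.exists_ne_zero_of_sum_ne_zero h

/-- The weight whose weighted degree is the degree in `x`. -/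
def xWeight (n : ℕ) : Weight n := (0, fun _ => 1)

theorem deg_xWeight (m : ℕ × (Fin n →₀ ℕ)) : deg (xWeight n) m = (m.2.degree : ℝ) := by
  simp [deg_apply, xWeight, Finsupp.degree_eq_sum]

theorem finite_xdegree_eq (d : ℝ) : {α : Fin n →₀ ℕ | (α.degree : ℝ) = d}.Finite := by
  refine (Set.finite_Iic (Finsupp.equivFunOnFinite.symm fun _ : Fin n => ⌊d⌋₊)).subset ?_
  intro α hα i
  change α i ≤ ⌊d⌋₊
  refine Nat.le_floor ?_
  rw [← (hα : (α.degree : ℝ) = d)]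
  exact_mod_cast Finsupp.le_degree i α

theorem mem_terms_homogeneousComponent {f : SeriesRing R n} {d : ℕ} {m : ℕ × (Fin n →₀ ℕ)} :
    m ∈ terms (MvPolynomial.homogeneousComponent d f) ↔ m.2.degree = d ∧ m ∈ terms f := by
  rw [mem_terms, mem_terms, termCoeff, MvPolynomial.coeff_homogeneousComponent]
  split_ifs with h <;> simp [h, termCoeff]

theorem isWeightHomogeneous_homogeneousComponent (f : SeriesRing R n) (d : ℕ) :
    IsWeightHomogeneous (xWeight n) d (MvPolynomial.homogeneousComponent d f) := fun m hm => by
  rw [deg_xWeight, (mem_terms_homogeneousComponent.1 hm).1]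

theorem homogeneousComponent_mem {I : Ideal (SeriesRing R n)} (hI : IsXHomogeneous I)
    {f : SeriesRing R n} (hf : f ∈ I) (d : ℕ) : MvPolynomial.homogeneousComponent d f ∈ I := by
  obtain ⟨S, hS, rfl⟩ := hI
  let := MvPolynomial.gradedAlgebra (σ := Fin n) (R := PowerSeries R)
  have h := Ideal.homogeneous_span (MvPolynomial.homogeneousSubmodule (Fin n) (PowerSeries R)) S
    fun g hg => (hS g hg).imp fun _ h => h
  have := h d hf
  rwa [show ((DirectSum.decompose (MvPolynomial.homogeneousSubmodule (Fin n) (PowerSeries R)) f d :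
    _) : SeriesRing R n) = MvPolynomial.homogeneousComponent d f from
    MvPolynomial.decomposition.decompose'_apply f d] at this

/-- For an `x`-homogeneous ideal `I`, it suffices to test a containment of initial ideals on the
`x`-homogeneous elements of `I`. -/
theorem initialIdeal_le_of_xhomogeneous {v : Weight n} (hv : v ∈ openLower n)
    {I : Ideal (SeriesRing R n)} (hI : IsXHomogeneous I) {J : Ideal (PolyRing R n)}
    (h : ∀ f ∈ I, ∀ d, IsWeightHomogeneous (xWeight n) d f → ∀ D,
      (∀ m ∈ terms f, deg v m ≤ D) → homPart v D f ∈ J) : initialIdeal v I ≤ J := by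
  refine initialIdeal_le hv fun f hf D hD => ?_
  rw [← MvPolynomial.sum_homogeneousComponent f, homPart_sum hv]
  refine sum_mem fun d _ => h _ (homogeneousComponent_mem hI hf d) d
    (isWeightHomogeneous_homogeneousComponent f d) D fun m hm => hD m ?_
  exact (mem_terms_homogeneousComponent.1 hm).2

theorem initialIdeal_eq_span_xhomogeneous {v : Weight n} (hv : v ∈ openLower n)
    {I : Ideal (SeriesRing R n)} (hI : IsXHomogeneous I) :
    initialIdeal v I =
      Ideal.span (initialForm v '' {f | f ∈ I ∧ ∃ d, IsWeightHomogeneous (xWeight n) d f}) := by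
  apply le_antisymm
  · refine initialIdeal_le_of_xhomogeneous hv hI fun f hf d hd D hD => ?_
    rcases homPart_eq_zero_or hv hD with h | h
    · rw [h]; exact zero_mem _
    · rw [h]; exact Ideal.subset_span ⟨f, ⟨hf, d, hd⟩, rfl⟩
  · exact Ideal.span_mono (Set.image_mono fun f hf => hf.1)

theorem isHomogeneousFor_xWeight_initialIdeal {v : Weight n} (hv : v ∈ openLower n)
    {I : Ideal (SeriesRing R n)} (hI : IsXHomogeneous I) :
    IsHomogeneousFor (xWeight n) (initialIdeal v I) := by
  rw [initialIdeal_eq_span_xhomogeneous hv hI]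
  refine isHomogeneousFor_span ?_
  rintro _ ⟨f, ⟨-, d, hd⟩, rfl⟩
  refine ⟨d, fun m hm => hd m ?_⟩
  classical
  rw [mem_terms, termCoeff_polyToSeries, coeff_initialForm v hv] at hm
  intro h0
  simp [h0] at hm

/-! ### Lifting elements of an initial ideal -/

/-- The triple of the `w`-weighted degree, the `u`-weighted degree and the degree in `x`. -/
def multiDeg (w u : Weight n) : ℕ × (Fin n →₀ ℕ) →+ ℝ × ℝ × ℝ :=
  (deg w).prod ((deg u).prod (deg (xWeight n)))

theorem multiDeg_apply (w u : Weight n) (m : ℕ × (Fin n →₀ ℕ)) :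
    multiDeg w u m = (deg w m, deg u m, deg (xWeight n) m) := rfl

theorem part_multiDeg_mem {w u : Weight n} {J : Ideal (PolyRing R n)} (hw : IsHomogeneousFor w J)
    (hu : IsHomogeneousFor u J) (hx : IsHomogeneousFor (xWeight n) J) {p : PolyRing R n}
    (hp : p ∈ J) (γ : ℝ × ℝ × ℝ) : part {m | multiDeg w u m = γ} (ι p) ∈ J := by
  convert hw _ (hu _ (hx p hp γ.2.2) γ.2.1) γ.1 using 1
  classical
  refine ext_poly fun m => ?_
  rw [termCoeff_part_poly, termCoeff_homPart_poly, termCoeff_homPart_poly, termCoeff_homPart_poly]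
  simp only [Set.mem_ofPred_eq, multiDeg_apply, Prod.ext_iff]
  split_ifs <;> simp_all

theorem part_eq_self {M : Set (ℕ × (Fin n →₀ ℕ))} {p : PolyRing R n}
    (hp : terms (ι p) ⊆ M) : part M (ι p) = p := by
  classical
  refine ext_poly fun m => ?_
  rw [termCoeff_part_poly, ite_eq_left_iff]
  intro h
  by_contra hne
  exact h (hp (Ne.symm hne))

/-- `p` lifts to an `x`-homogeneous element of `I` of `x`-degree `γ₃`, up to terms of
`w`-weighted degree less than `γ₁` and `u`-weighted degree less than `γ₂`. -/
def Liftable (I : Ideal (SeriesRing R n)) (w u : Weight n) (γ : ℝ × ℝ × ℝ) (p : PolyRing R n) :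
    Prop :=
  ∃ f ∈ I, IsWeightHomogeneous (xWeight n) γ.2.2 f ∧
    ∀ m ∈ terms (f - ι p), deg w m < γ.1 ∧ deg u m < γ.2.1

theorem liftable_zero (I : Ideal (SeriesRing R n)) (w u : Weight n) (γ : ℝ × ℝ × ℝ) :
    Liftable I w u γ 0 :=
  ⟨0, zero_mem _, fun m hm => by simp [terms_zero] at hm, fun m hm => by simp [terms_zero] at hm⟩

theorem Liftable.add {I : Ideal (SeriesRing R n)} {w u : Weight n} {γ : ℝ × ℝ × ℝ}
    {p q : PolyRing R n} (hp : Liftable I w u γ p) (hq : Liftable I w u γ q) :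
    Liftable I w u γ (p + q) := by
  obtain ⟨f, hf, hfx, hfp⟩ := hp
  obtain ⟨g, hg, hgx, hgq⟩ := hq
  refine ⟨f + g, add_mem hf hg, fun m hm => (mem_terms_add hm).elim (hfx m) (hgx m),
    fun m hm => ?_⟩
  rw [map_add, add_sub_add_comm] at hm
  exact (mem_terms_add hm).elim (hfp m) (hgq m)

theorem Liftable.mul {I : Ideal (SeriesRing R n)} {w u : Weight n} {γ γ' : ℝ × ℝ × ℝ}
    {a p : PolyRing R n} (ha : ∀ m ∈ terms (ι a), multiDeg w u m = γ')
    (hp : Liftable I w u γ p) : Liftable I w u (γ' + γ) (a * p) := by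
  obtain ⟨f, hf, hfx, hfp⟩ := hp
  refine ⟨ι a * f, Ideal.mul_mem_left _ _ hf, fun m hm => ?_, fun m hm => ?_⟩
  · obtain ⟨m₁, h₁, m₂, h₂, rfl⟩ := mem_terms_mul hm
    rw [map_add, hfx m₂ h₂, ← ha m₁ h₁]
    rfl
  · rw [map_mul, ← mul_sub] at hm
    obtain ⟨m₁, h₁, m₂, h₂, rfl⟩ := mem_terms_mul hm
    obtain ⟨hlt, hlt'⟩ := hfp m₂ h₂
    rw [map_add, map_add, ← ha m₁ h₁]
    exact ⟨add_lt_add_right hlt _, add_lt_add_right hlt' _⟩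

/-- If generators of an ideal are multihomogeneous and liftable, then so are all multihomogeneous
components of its elements. -/
theorem liftable_part {I : Ideal (SeriesRing R n)} {w u : Weight n} {G : Set (PolyRing R n)}
    (hG : ∀ g ∈ G, ∃ γ, (∀ m ∈ terms (ι g), multiDeg w u m = γ) ∧ Liftable I w u γ g)
    {p : PolyRing R n} (hp : p ∈ Ideal.span G) (γ : ℝ × ℝ × ℝ) :
    Liftable I w u γ (part {m | multiDeg w u m = γ} (ι p)) := by
  induction hp using Submodule.closure_induction with
  | zero =>
    rw [map_zero, part_zero]
    exact liftable_zero I w u γ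
  | add p q _ _ hp hq =>
    rw [part_poly_add]
    exact hp.add hq
  | smul_mem a g hg =>
    obtain ⟨γ₀, hγ₀, hlift⟩ := hG g hg
    have : part {m | multiDeg w u m = γ} (ι (a * g)) =
        part {m | multiDeg w u m = γ - γ₀} (ι a) * g :=
      part_mul_poly fun m m' hm' => by
        simp only [Set.mem_ofPred_eq, map_add, hγ₀ m' hm', eq_sub_iff_add_eq]
    rw [smul_eq_mul, this, ← sub_add_cancel γ γ₀]
    refine Liftable.mul (fun m hm => ?_) hlift
    rw [sub_add_cancel] at hm
    exact (mem_terms_part_poly.1 hm).1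

/-- A `w`-homogeneous, `x`-homogeneous element of `in_w(I)` is the initial form of an
`x`-homogeneous element of `I`. -/
theorem exists_lift_of_mem_initialIdeal {I : Ideal (SeriesRing R n)} (hI : IsXHomogeneous I)
    {w : Weight n} (hw : w ∈ openLower n) {p : PolyRing R n} (hp : p ∈ initialIdeal w I)
    {e d : ℝ} (he : IsWeightHomogeneous w e (ι p))
    (hd : IsWeightHomogeneous (xWeight n) d (ι p)) :
    ∃ f ∈ I, IsWeightHomogeneous (xWeight n) d f ∧ ∀ m ∈ terms (f - ι p), deg w m < e := by
  rw [initialIdeal_eq_span_xhomogeneous hw hI] at hp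
  have hlift := liftable_part (I := I) (w := w) (u := w) ?_ hp (e, e, d)
  · rw [part_eq_self fun m hm => ?_] at hlift
    · obtain ⟨f, hf, hfx, hfp⟩ := hlift
      exact ⟨f, hf, hfx, fun m hm => (hfp m hm).1⟩
    · simp only [Set.mem_ofPred_eq, multiDeg_apply, he m hm, hd m hm]
  · rintro _ ⟨f, ⟨hf, d, hd⟩, rfl⟩
    by_cases h0 : f = 0
    · refine ⟨0, fun m hm => ?_, ?_⟩
      · simp [h0, initialForm_zero hw, terms_zero] at hm
      · rw [h0, initialForm_zero hw]
        exact liftable_zero _ _ _ _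
    · obtain ⟨m₀, hm₀, hmax⟩ := exists_top_degree hw h0
      rw [initialForm_eq_homPart hw hm₀ hmax]
      refine ⟨(deg w m₀, deg w m₀, d), fun m hm => ?_, f, hf, hd, fun m hm => ?_⟩
      · have := (mem_terms_part (finite_deg_eq hw _ f)).1 hm
        rw [multiDeg_apply, hd m this.2, show deg w m = deg w m₀ from this.1]
      · have hlt : deg w m < deg w m₀ := by
          classical
          rw [mem_terms, termCoeff_sub, termCoeff_homPart hw] at hm
          split_ifs at hm with h
          · simp at hm
          · rw [sub_zero] at hm
            exact lt_of_le_of_ne (hmax m hm) h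
        exact ⟨hlt, hlt⟩

/-! ### Perturbation of the weight -/

open Topology Filter in
/-- Strict upper bounds on weighted degrees survive small perturbations of the weight: for each
of the finitely many exponents of `x`, only the lowest power of `t` has to be checked. -/
theorem eventually_deg_lt {w : Weight n} (hw : w ∈ openLower n) (v : Weight n) {e : ℝ} (s : ℝ)
    {f : SeriesRing R n} (hf : ∀ m ∈ terms f, deg w m < e) :
    ∀ᶠ ε : ℝ in 𝓝 0, ∀ m ∈ terms f, deg (w + ε • v) m < e + ε * s := by
  have hw' : w.1 < 0 := hw
  have hneg : ∀ᶠ ε : ℝ in 𝓝 0, (w + ε • v).1 < 0 := by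
    have hc : ContinuousAt (fun ε : ℝ => (w + ε • v).1) 0 := by fun_prop
    exact hc.eventually_lt continuousAt_const (by simpa using hw')
  have hmain : ∀ α ∈ f.support, ∀ᶠ ε : ℝ in 𝓝 0, ∀ β, (β, α) ∈ terms f →
      deg (w + ε • v) (β, α) < e + ε * s := by
    intro α hα
    have hex : ∃ β, (β, α) ∈ terms f := by
      by_contra! hc
      rw [MvPolynomial.mem_support_iff] at hα
      refine hα (PowerSeries.ext fun β => ?_)
      have := hc β
      rw [mem_terms, not_not] at this
      simpa [termCoeff] using this
    classical
    obtain ⟨b, hb, hmin⟩ : ∃ b, (b, α) ∈ terms f ∧ ∀ β, (β, α) ∈ terms f → b ≤ β :=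
      ⟨Nat.find hex, Nat.find_spec hex, fun β hβ => Nat.find_min' hex hβ⟩
    have hlow : ∀ᶠ ε : ℝ in 𝓝 0, deg w (b, α) + ε * deg v (b, α) < e + ε * s := by
      have hc : ContinuousAt (fun ε : ℝ => deg w (b, α) + ε * deg v (b, α)) 0 := by fun_prop
      have hc' : ContinuousAt (fun ε : ℝ => e + ε * s) 0 := by fun_prop
      exact hc.eventually_lt hc' (by simpa using hf _ hb)
    filter_upwards [hlow, hneg] with ε h₁ h₂ β hβ
    rw [← deg_smul_weight, ← deg_add_weight] at h₁
    refine lt_of_le_of_lt ?_ h₁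
    rw [deg_apply, deg_apply]
    have : (b : ℝ) ≤ β := by exact_mod_cast hmin β hβ
    exact add_le_add_left (mul_le_mul_of_nonpos_left this h₂.le) _
  rw [← Filter.eventually_all_finset] at hmain
  filter_upwards [hmain] with ε h m hm
  exact h m.2 (snd_mem_support hm) m.1 hm

/-- Suppose that all multihomogeneous components of the elements of a `u`-homogeneous ideal `J`
containing `in_w(I)` lift to `I`. Then `J` also contains the initial forms at `u` of the
`x`-homogeneous elements of `I`: otherwise a counterexample of minimal `w`-weighted degree exists, and subtracting a lift of its initial form lowers this degree
without affecting its top `u`-homogeneous component modulo `J`. -/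
theorem homPart_mem_of_liftable {I : Ideal (SeriesRing R n)} {w u : Weight n}
    (hw : w ∈ openLower n) (hu : u ∈ openLower n) {J : Ideal (PolyRing R n)}
    (hJ : IsHomogeneousFor u J) (hIJ : initialIdeal w I ≤ J)
    (hlift : ∀ p ∈ J, ∀ γ, Liftable I w u γ (part {m | multiDeg w u m = γ} (ι p)))
    (f : SeriesRing R n) (hf : f ∈ I) (d : ℝ) (hd : IsWeightHomogeneous (xWeight n) d f) (D : ℝ)
    (hD : ∀ m ∈ terms f, deg u m ≤ D) : homPart u D f ∈ J := by
  by_contra hbad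
  -- The counterexamples, with a term at which the maximal `w`-weighted degree is attained.
  let Bad : SeriesRing R n → ℕ × (Fin n →₀ ℕ) → Prop := fun f m =>
    f ∈ I ∧ IsWeightHomogeneous (xWeight n) d f ∧ (∀ m ∈ terms f, deg u m ≤ D) ∧
      homPart u D f ∉ J ∧ m ∈ terms f ∧ ∀ m' ∈ terms f, deg w m' ≤ deg w m
  have hexists : ∀ f ∈ I, IsWeightHomogeneous (xWeight n) d f → (∀ m ∈ terms f, deg u m ≤ D) →
      homPart u D f ∉ J → ∃ m, Bad f m := by
    intro f hf hd hD hbad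
    have h0 : f ≠ 0 := by
      rintro rfl
      exact hbad (by simp [homPart, part_zero])
    obtain ⟨m, hm, hmax⟩ := exists_top_degree hw h0
    exact ⟨m, hf, hd, hD, hbad, hm, hmax⟩
  have hfin : {m | ∃ f, Bad f m}.Finite := by
    have hA := finite_xdegree_eq (n := n) d
    have hx : ∀ f : SeriesRing R n, IsWeightHomogeneous (xWeight n) d f → ∀ m ∈ terms f,
        m.2 ∈ {α : Fin n →₀ ℕ | (α.degree : ℝ) = d} := fun f hd m hm => by
      have := hd m hm
      rwa [deg_xWeight] at this
    -- A counterexample has a term of `u`-weighted degree `D`, which bounds its `w`-weighted degree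
    -- from below by some `c` that depends on `d` and `D` only.
    obtain ⟨c, hc⟩ := ((finite_le_deg hu hA D).image (deg w)).bddBelow
    refine (finite_le_deg hw hA c).subset ?_
    rintro m ⟨f, -, hd, hD, hbad, hm, hmax⟩
    refine ⟨hx f hd m hm, ?_⟩
    obtain ⟨m₁, hm₁, h₁⟩ : ∃ m ∈ terms f, D ≤ deg u m := by
      by_contra! hlt
      exact hbad (homPart_eq_zero hu hlt ▸ zero_mem _)
    exact (hc (Set.mem_image_of_mem _ ⟨hx f hd m₁ hm₁, h₁⟩)).trans (hmax m₁ hm₁)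
  obtain ⟨m₀, ⟨f, hf, hd, hD, hbad, hm₀, hmax⟩, hmin⟩ := Set.exists_min_image _ (deg w) hfin
    ((hexists f hf hd hD hbad).imp fun m hm => ⟨f, hm⟩)
  -- The initial form of `f` is split into multihomogeneous parts, each of which is lifted.
  set p := homPart w (deg w m₀) f
  have hpf : ∀ m ∈ terms (ι p), deg w m = deg w m₀ ∧ m ∈ terms f := fun m hm =>
    (mem_terms_part (finite_deg_eq hw _ f)).1 hm
  have hpJ : p ∈ J := hIJ (homPart_mem_initialIdeal hw hf hmax)
  have hlift' : ∀ γ, ∃ g ∈ I, IsWeightHomogeneous (xWeight n) d g ∧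
      ∀ m ∈ terms (g - ι (part {m | multiDeg w u m = γ} (ι p))),
        deg w m < deg w m₀ ∧ deg u m < D := by
    intro γ
    by_cases h0 : part {m | multiDeg w u m = γ} (ι p) = 0
    · rw [h0]
      exact ⟨0, zero_mem _, fun m hm => by simp [terms_zero] at hm,
        fun m hm => by simp [terms_zero] at hm⟩
    · obtain ⟨m, hm⟩ : (terms (ι (part {m | multiDeg w u m = γ} (ι p)))).Nonempty := by
        rw [Set.nonempty_iff_ne_empty]
        intro h
        exact h0 (polyToSeries_injective ((eq_zero_of_terms_eq_empty h).trans (map_zero _).symm))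
      rw [mem_terms_part_poly] at hm
      obtain ⟨hγ, hm⟩ := hm
      obtain ⟨hmw, hmf⟩ := hpf m hm
      obtain ⟨g, hg, hgx, hgp⟩ := hlift p hpJ γ
      rw [← (hγ : multiDeg w u m = γ)] at hgx hgp ⊢
      rw [multiDeg_apply, hd m hmf] at hgx
      exact ⟨g, hg, hgx, fun a ha => ⟨(hgp a ha).1.trans_eq hmw, (hgp a ha).2.trans_le (hD m hmf)⟩⟩
  choose g hgI hgx hgp using hlift'
  obtain ⟨S, hS⟩ := exists_eq_sum_part (multiDeg w u) p
  set r : SeriesRing R n :=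
    ∑ γ ∈ S, (g γ - ι (part {m | multiDeg w u m = γ} (ι p))) with hr
  have hr_lt : ∀ m ∈ terms r, deg w m < deg w m₀ ∧ deg u m < D := fun m hm => by
    obtain ⟨γ, -, h⟩ := mem_terms_sum hm
    exact hgp γ m h
  have hsum : r = ∑ γ ∈ S, g γ - ι p := by
    rw [hr, Finset.sum_sub_distrib]
    conv_rhs => rw [hS, map_sum]
  have hf' : f - ∑ γ ∈ S, g γ = (f - ι p) - r := by rw [hsum]; ring
  obtain ⟨m₁, hm₁⟩ := hexists (f - ∑ γ ∈ S, g γ) (sub_mem hf (sum_mem fun γ _ => hgI γ))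
    (fun m hm => (mem_terms_sub hm).elim (hd m) fun h => by
      obtain ⟨γ, -, h⟩ := mem_terms_sum h
      exact hgx γ m h)
    (fun m hm => by
      rw [hf'] at hm
      rcases mem_terms_sub hm with h | h
      · rcases mem_terms_sub h with h | h
        · exact hD m h
        · exact hD m (hpf m h).2
      · exact (hr_lt m h).2.le)
    (fun hmem => hbad (by
      have hdecomp : f = (f - ∑ γ ∈ S, g γ) + (ι p + r) := by rw [hf']; ring
      rw [hdecomp, homPart_add hu, homPart_add hu, homPart_eq_zero hu fun m hm => (hr_lt m hm).2,
        add_zero]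
      exact add_mem hmem (hJ p hpJ D)))
  have hle := hmin m₁ ⟨_, hm₁⟩
  have hm₁' := hm₁.2.2.2.2.1
  rw [hf'] at hm₁'
  refine absurd hle (not_le.2 ?_)
  rcases mem_terms_sub hm₁' with h | h
  · classical
    rw [mem_terms, termCoeff_sub, termCoeff_homPart hw] at h
    split_ifs at h with hdeg
    · simp at h
    · rw [sub_zero] at h
      exact lt_of_le_of_ne (hmax m₁ h) hdeg
  · exact (hr_lt m₁ h).1

open Topology Filter in
/-- If `in_w(I)` is `v`-homogeneous, then moving `w` slightly in the direction of `v` does not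
change the initial ideal. -/
theorem eventually_initialIdeal_eq [IsNoetherianRing R] {I : Ideal (SeriesRing R n)}
    (hI : IsXHomogeneous I) {w v : Weight n} (hw : w ∈ openLower n)
    (hv : IsHomogeneousFor v (initialIdeal w I)) :
    ∀ᶠ ε : ℝ in 𝓝 0, w + ε • v ∈ openLower n ∧
      initialIdeal (w + ε • v) I = initialIdeal w I := by
  classical
  have hw' : w.1 < 0 := hw
  set J := initialIdeal w I
  have hJw : IsHomogeneousFor w J := isHomogeneousFor_initialIdeal hw I
  have hJx : IsHomogeneousFor (xWeight n) J := isHomogeneousFor_xWeight_initialIdeal hw hI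
  obtain ⟨F, hF⟩ : J.FG := IsNoetherian.noetherian J
  choose S hS using fun p : PolyRing R n => exists_eq_sum_part (multiDeg w v) p
  let G : Finset (PolyRing R n) := F.biUnion fun p =>
    (S p).image fun γ => part {m | multiDeg w v m = γ} (ι p)
  have hGmem : ∀ g ∈ G, g ∈ J ∧ ∃ γ, ∀ m ∈ terms (ι g), multiDeg w v m = γ := by
    intro g hg
    simp only [G, Finset.mem_biUnion, Finset.mem_image] at hg
    obtain ⟨p, hp, γ, -, rfl⟩ := hg
    exact ⟨part_multiDeg_mem hJw hv hJx (hF ▸ Ideal.subset_span hp) γ, γ,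
      fun m hm => (mem_terms_part_poly.1 hm).1⟩
  have hGspan : Ideal.span (G : Set (PolyRing R n)) = J := by
    refine le_antisymm (Ideal.span_le.2 fun g hg => (hGmem g hg).1) ?_
    conv_lhs => rw [← hF]
    refine Ideal.span_le.2 fun p hp => ?_
    rw [SetLike.mem_coe, hS p]
    refine sum_mem fun γ hγ => Ideal.subset_span ?_
    exact Finset.mem_coe.2 (Finset.mem_biUnion.2 ⟨p, hp, Finset.mem_image_of_mem _ hγ⟩)
  have hlift : ∀ g ∈ G, ∀ᶠ ε : ℝ in 𝓝 0, ∃ γ,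
      (∀ m ∈ terms (ι g), multiDeg w (w + ε • v) m = γ) ∧ Liftable I w (w + ε • v) γ g := by
    intro g hg
    obtain ⟨hgJ, γ, hγ⟩ := hGmem g hg
    obtain ⟨f, hf, hfx, hfg⟩ := exists_lift_of_mem_initialIdeal hI hw hgJ (e := γ.1) (d := γ.2.2)
      (fun m hm => congrArg (fun t => t.1) (hγ m hm))
      (fun m hm => congrArg (fun t => t.2.2) (hγ m hm))
    filter_upwards [eventually_deg_lt hw v γ.2.1 hfg] with ε hε
    refine ⟨(γ.1, γ.1 + ε * γ.2.1, γ.2.2), fun m hm => ?_, f, hf, hfx,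
      fun m hm => ⟨hfg m hm, hε m hm⟩⟩
    rw [← hγ m hm, multiDeg_apply, multiDeg_apply, deg_add_weight, deg_smul_weight]
  have hneg : ∀ᶠ ε : ℝ in 𝓝 0, (w + ε • v).1 < 0 := by
    have hc : ContinuousAt (fun ε : ℝ => (w + ε • v).1) 0 := by fun_prop
    exact hc.eventually_lt continuousAt_const (by simpa using hw')
  rw [← Filter.eventually_all_finset] at hlift
  filter_upwards [hlift, hneg] with ε hε hu
  have hu : w + ε • v ∈ openLower n := hu
  have hJu : IsHomogeneousFor (w + ε • v) J :=
    add_mem (S := Submodule ℝ (Weight n)) (s := homogeneityWeights J) hJw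
      ((homogeneityWeights J).smul_mem ε hv)
  refine ⟨hu, le_antisymm (initialIdeal_le_of_xhomogeneous hu hI ?_) ?_⟩
  · refine homPart_mem_of_liftable hw hu hJu le_rfl fun p hp γ => ?_
    rw [← hGspan] at hp
    exact liftable_part hε hp γ
  · conv_lhs => rw [← hGspan]
    refine Ideal.span_le.2 fun g hg => ?_
    obtain ⟨γ, hγ, f, hf, -, hfg⟩ := hε g hg
    have hgu : IsWeightHomogeneous (w + ε • v) γ.2.1 (ι g) := fun m hm =>
      congrArg (fun t => t.2.1) (hγ m hm)
    have hfeq : f = (f - ι g) + ι g := by ring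
    have : homPart (w + ε • v) γ.2.1 f = g := by
      rw [hfeq, homPart_add hu, homPart_eq_zero hu fun m hm => (hfg m hm).2, zero_add,
        homPart_self hgu]
    rw [SetLike.mem_coe, ← this]
    refine homPart_mem_initialIdeal hu hf fun m hm => ?_
    rw [hfeq] at hm
    exact (mem_terms_add hm).elim (fun h => (hfg m h).2.le) fun h => (hgu m h).le

/-! ### The Gröbner cone and the homogeneity space -/

theorem isClosed_homogeneityWeights (J : Ideal (PolyRing R n)) :
    IsClosed (homogeneityWeights J : Set (Weight n)) :=
  Submodule.closed_of_finiteDimensional _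

open Topology Filter in
theorem tendsto_add_smul_nhdsGT (v u : Weight n) :
    Tendsto (fun ε : ℝ => v + ε • u) (𝓝[>] 0) (𝓝 v) := by
  have : Tendsto (fun ε : ℝ => v + ε • u) (𝓝 0) (𝓝 (v + (0 : ℝ) • u)) :=
    Continuous.tendsto (by fun_prop) 0
  rw [zero_smul, add_zero] at this
  exact this.mono_left nhdsWithin_le_nhds

/-- A linear subspace meeting the open half space meets the closed half space in the closure of
its intersection with the open one. -/
theorem closure_inter_openLower {H : Submodule ℝ (Weight n)} {w : Weight n} (hwH : w ∈ H)
    (hw : w ∈ openLower n) :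
    closure {v | v ∈ openLower n ∧ v ∈ H} = (H : Set (Weight n)) ∩ closedLower n := by
  have hw' : w.1 < 0 := hw
  apply Set.Subset.antisymm
  · refine closure_minimal (fun v hv => ⟨hv.2, (show v.1 < 0 from hv.1).le⟩) ?_
    exact (Submodule.closed_of_finiteDimensional H).inter
      (isClosed_le continuous_fst continuous_const)
  · rintro v ⟨hvH, hv⟩
    have hv' : v.1 ≤ 0 := hv
    refine mem_closure_of_tendsto (tendsto_add_smul_nhdsGT v w) ?_
    filter_upwards [self_mem_nhdsWithin] with ε hε
    refine ⟨?_, H.add_mem hvH (H.smul_mem ε hwH)⟩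
    have : ε * w.1 < 0 := mul_neg_of_pos_of_neg hε hw'
    change v.1 + ε * w.1 < 0
    linarith

/-- The weights for which `in_w(I)` is homogeneous are those in the span of the Gröbner cone. -/
theorem span_groebnerCone [IsNoetherianRing R] {I : Ideal (SeriesRing R n)}
    (hI : IsXHomogeneous I) {w : Weight n} (hw : w ∈ openLower n) :
    Submodule.span ℝ (groebnerCone w I) = homogeneityWeights (initialIdeal w I) := by
  apply le_antisymm
  · rw [Submodule.span_le]
    refine closure_minimal ?_ (isClosed_homogeneityWeights _)
    rintro v ⟨hv, hvw⟩
    rw [← hvw]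
    exact isHomogeneousFor_initialIdeal hv I
  · intro v hv
    obtain ⟨ε, ⟨hu, hε⟩, hpos⟩ := (((eventually_initialIdeal_eq hI hw hv).filter_mono
      nhdsWithin_le_nhds).and (self_mem_nhdsWithin (s := Set.Ioi (0 : ℝ)))).exists
    have h₁ : w ∈ Submodule.span ℝ (groebnerCone w I) :=
      Submodule.subset_span (subset_closure ⟨hw, rfl⟩)
    have h₂ : w + ε • v ∈ Submodule.span ℝ (groebnerCone w I) :=
      Submodule.subset_span (subset_closure ⟨hu, hε⟩)
    have h₃ := Submodule.sub_mem _ h₂ h₁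
    rw [add_sub_cancel_left] at h₃
    exact (Submodule.smul_mem_iff _ (ne_of_gt hpos)).1 h₃

/-- The weights for which `J` is homogeneous lie in every Gröbner cone of the extension of `J`:
from such a weight `v`, moving slightly towards any `u` leads to weights with initial ideal
`in_u(J)`. -/
theorem closure_subset_groebnerCone (J : Ideal (PolyRing R n)) {u : Weight n}
    (hu : u ∈ openLower n) :
    closure {v | v ∈ openLower n ∧ v ∈ homogeneityWeights J} ⊆ groebnerCone u (extend J) := by
  refine closure_minimal ?_ isClosed_closure
  rintro v ⟨hv, hvJ⟩
  refine mem_closure_of_tendsto (tendsto_add_smul_nhdsGT v u) ?_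
  filter_upwards [self_mem_nhdsWithin] with ε hε
  have hvu : v + ε • u ∈ openLower n :=
    add_neg hv (mul_neg_of_pos_of_neg hε hu : ε * u.1 < 0)
  exact ⟨hvu, initialIdeal_extend_add_smul hv hu hε hvu hvJ⟩

end GroebnerFan

end

open GroebnerFan in
theorem mainTheorem9 {R : Type*} [CommRing R] [IsNoetherianRing R] {n : ℕ}
    (I : Ideal (GroebnerFan.SeriesRing R n)) (hI : GroebnerFan.IsXHomogeneous I)
    (w : GroebnerFan.Weight n) (hw : w ∈ GroebnerFan.openLower n) :
    GroebnerFan.homogeneitySpace (GroebnerFan.extend (GroebnerFan.initialIdeal w I)) =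
        closure {v : GroebnerFan.Weight n | v ∈ GroebnerFan.openLower n ∧
          GroebnerFan.initialIdeal v (GroebnerFan.extend (GroebnerFan.initialIdeal w I)) =
            GroebnerFan.initialIdeal w I} ∧
      closure {v : GroebnerFan.Weight n | v ∈ GroebnerFan.openLower n ∧
          GroebnerFan.initialIdeal v (GroebnerFan.extend (GroebnerFan.initialIdeal w I)) =
            GroebnerFan.initialIdeal w I} =
        (Submodule.span ℝ (GroebnerFan.groebnerCone w I) : Set (GroebnerFan.Weight n)) ∩
          GroebnerFan.closedLower n := by
  set J := initialIdeal w I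
  have hset : {v : Weight n | v ∈ openLower n ∧ initialIdeal v (extend J) = J} =
      {v | v ∈ openLower n ∧ v ∈ homogeneityWeights J} :=
    Set.ext fun v => and_congr_right fun hv => initialIdeal_extend_eq_iff hv J
  have hwJ : IsHomogeneousFor w J := isHomogeneousFor_initialIdeal hw I
  refine ⟨Set.Subset.antisymm ?_ ?_, ?_⟩
  · have h := Set.biInter_subset_of_mem (t := fun u => groebnerCone u (extend J)) hw
    rwa [groebnerCone, initialIdeal_extend hw hwJ] at h
  · rw [hset]
    exact Set.subset_iInter₂ fun u hu => closure_subset_groebnerCone J hu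
  · rw [hset, closure_inter_openLower hwJ hw, span_groebnerCone hI hw]
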